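/- Let $G$ be a locally compact Hausdorff group with identity $e$ and a fixed (regular) left Haar measure, written $dr$, and let $\omega:G\to[0,\infty)$ be a weight, i.e. a non-zero Borel measurable function with $\omega(st)\le\omega(s)\omega(t)$ for all $s,t\in G$. All vector spaces are real. Let $L^1(G,\omega)$ be the completion of $C_c(G)$ in the norm $\|f\|_{1,\omega}=\int_G|f(s)|\omega(s)\,ds$, with the multiplication that extends the convolution $(f*g)(s)=\int_G f(r)g(r^{-1}s)\,dr$ continuously and with the closure of $\{f\in C_c(G): f\ge 0\}$ as its cone. Let $X$ be a real Banach space with a closed cone $X_+$ (a non-empty closed set with $X_++X_+\subseteq X_+$ and $\lambda X_+\subseteq X_+$ for all $\lambda\ge0$). Let $\mathcal U$ be the set of all group homomorphisms $U$ from $G$ to the invertible bounded operators on $X$ such that $U_r^{\pm1}X_+\subseteq X_+$ for all $r\in G$, $r\mapsto U_rx$ is continuous for all $x\in X$, and there is a constant $C_U\ge0$ with $\|U_r\|\le C_U\,\omega(r)$ for all $r\in G$. Let $\mathcal T$ be the set of all bounded algebra homomorphisms $T:L^1(G,\omega)\to B(X)$ such that $T(f)X_+\subseteq X_+$ for all $f\in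 L^1(G,\omega)_+$ and the span of $\{T(f)x: f\in L^1(G,\omega),\,x\in X\}$ is dense in $X$. Then there are mutually inverse bijections $\mathcal U\to\mathcal T$, $U\mapsto T^U$, and $\mathcal T\to\mathcal U$, $T\mapsto U^T$, where $T^U$ is determined by $$T^U(f)x=\int_G f(r)\,U_rx\,dr\qquad(f\in C_c(G),\ x\in X),$$ and $U^T$ is given by $$U^T_s x=\lim_{V\in\mathcal Z}T\big(z_V(s^{-1}\,\cdot\,)\big)x\qquad(s\in G,\ x\in X),$$ for every neighbourhood base $\mathcal Z$ of $e$ (directed by reverse inclusion) of which all elements are contained in a fixed compact set, and every choice of functions $z_V\in C_c(G)$ $(V\in\mathcal Z)$ such that $z_V\ge0$, $z_V$ is supported in $V$, and $\int_G z_V(r)\,dr=1$. Moreover, if $\inf_{W\in\mathcal Z}\sup_{r\in W}\omega(r)=1$ for some neighbourhood base $\mathcal Z$ of $e$ of which all elements are contained in a fixed compact set, then $\|T^U\|=\sup_{r\in G}\|U_r\|/\omega(r)$ for all $U\in\mathcal U$, and $\|U^T_r\|\le\|T\|\,\omega(r)$ for all $T\in\mathcal T$ and $r\in G$. -/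

import Mathlib

open MeasureTheory Filter Topology UniformSpace CompactlySupported
open scoped Pointwise

/-- A weight on `G`: a non-zero submultiplicative Borel measurable function `G → [0, ∞)`. -/
structure Weight (G : Type*) [Group G] [MeasurableSpace G] where
  /-- The underlying function. -/
  toFun : G → ℝ
  nonneg : ∀ s, 0 ≤ toFun s
  nonzero : ∃ s, toFun s ≠ 0
  submul : ∀ s t, toFun (s * t) ≤ toFun s * toFun t
  measurable : Measurable toFun

namespace Weight

instance {G : Type*} [Group G] [MeasurableSpace G] : CoeFun (Weight G) (fun _ => G → ℝ) :=
  ⟨Weight.toFun⟩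

/-- A weight is bounded on compact sets. -/
theorem exists_bound {G : Type*} [Group G] [TopologicalSpace G] [IsTopologicalGroup G]
    [LocallyCompactSpace G] [MeasurableSpace G] [BorelSpace G]
    (ω : Weight G) (μ : Measure G) [μ.IsHaarMeasure] [μ.Regular] {K : Set G} (hK : IsCompact K) :
    ∃ b : ℝ, ∀ s ∈ K, ω s ≤ b := by
  obtain ⟨L, hL, hL1⟩ := exists_compact_mem_nhds (1 : G)
  let E : ℕ → Set G := fun n => {x | ω x ≤ n ∧ ω x⁻¹ ≤ n}
  have hEm : ∀ n, MeasurableSet (E n) := fun n =>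
    (measurableSet_le ω.measurable measurable_const).inter
      (measurableSet_le (ω.measurable.comp continuous_inv.measurable) measurable_const)
  have hpos : 0 < μ (interior L) :=
    isOpen_interior.measure_pos μ ⟨1, mem_interior_iff_mem_nhds.2 hL1⟩
  have hcov : interior L ⊆ ⋃ n, (E n ∩ interior L) := by
    intro x hx
    obtain ⟨n, hn⟩ := exists_nat_ge (max (ω x) (ω x⁻¹))
    exact Set.mem_iUnion.2 ⟨n, ⟨(le_max_left _ _).trans hn, (le_max_right _ _).trans hn⟩, hx⟩
  obtain ⟨n, hn⟩ : ∃ n, 0 < μ (E n ∩ interior L) := by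
    by_contra! h
    have h0 : μ (⋃ n, (E n ∩ interior L)) = 0 :=
      measure_iUnion_null fun n => nonpos_iff_eq_zero.1 (h n)
    exact hpos.ne' (measure_mono_null hcov h0)
  have hfin : μ (E n ∩ interior L) ≠ ⊤ :=
    ((measure_mono (Set.inter_subset_right.trans interior_subset)).trans_lt hL.measure_lt_top).ne
  have hD := Measure.div_mem_nhds_one_of_haar_pos_ne_top μ (E n ∩ interior L)
    ((hEm n).inter isOpen_interior.measurableSet) hn hfin
  have hloc : ∀ u ∈ (E n ∩ interior L) / (E n ∩ interior L), ω u ≤ n * n := by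
    rintro u ⟨x, hx, y, hy, rfl⟩
    simp only [div_eq_mul_inv]
    exact (ω.submul _ _).trans
      (mul_le_mul hx.1.1 hy.1.2 (ω.nonneg _) (Nat.cast_nonneg _))
  refine hK.induction_on (p := fun S => ∃ b : ℝ, ∀ s ∈ S, ω s ≤ b) ⟨0, by simp⟩ ?_ ?_ ?_
  · rintro S T hST ⟨b, hb⟩
    exact ⟨b, fun s hs => hb s (hST hs)⟩
  · rintro S T ⟨b, hb⟩ ⟨c, hc⟩
    refine ⟨max b c, fun s hs => hs.elim (fun h => (hb s h).trans (le_max_left _ _))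
      (fun h => (hc s h).trans (le_max_right _ _))⟩
  · intro x _
    refine ⟨_, mem_nhdsWithin_of_mem_nhds ((smul_mem_nhds_self (g := x)).2 hD),
      ω x * (n * n), ?_⟩
    rintro _ ⟨u, hu, rfl⟩
    exact (ω.submul _ _).trans (mul_le_mul_of_nonneg_left (hloc u hu) (ω.nonneg _))

/-- The product of a continuous compactly supported function and a weight is integrable. -/
theorem integrable_mul {G : Type*} [Group G] [TopologicalSpace G] [IsTopologicalGroup G]
    [LocallyCompactSpace G] [MeasurableSpace G] [BorelSpace G]
    (ω : Weight G) (μ : Measure G) [μ.IsHaarMeasure] [μ.Regular]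
    {f : G → ℝ} (hf : Continuous f) (hc : HasCompactSupport f) :
    Integrable (fun s => f s * ω s) μ := by
  obtain ⟨b, hb⟩ := ω.exists_bound μ hc
  refine Integrable.mono' ((hf.integrable_of_hasCompactSupport hc).norm.mul_const b)
    (hf.measurable.mul ω.measurable).aestronglyMeasurable (ae_of_all _ fun s => ?_)
  rw [norm_mul, Real.norm_of_nonneg (ω.nonneg s)]
  by_cases hs : s ∈ tsupport f
  · exact mul_le_mul_of_nonneg_left (hb s hs) (norm_nonneg _)
  · simp [image_eq_zero_of_notMem_tsupport hs]

end Weight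

section Beurling

set_option linter.unusedSectionVars false

variable {G : Type*} [Group G] [TopologicalSpace G] [MeasurableSpace G]

/-- The space `C_c(G)`, to be endowed with the weighted norm `∫ |f| ω dμ`. -/
def WeightedCc (_ω : Weight G) (_μ : Measure G) : Type _ := C_c(G, ℝ)

namespace WeightedCc

variable (ω : Weight G) (μ : Measure G)

instance : AddCommGroup (WeightedCc ω μ) := inferInstanceAs (AddCommGroup C_c(G, ℝ))

instance : Module ℝ (WeightedCc ω μ) := inferInstanceAs (Module ℝ C_c(G, ℝ))

instance : FunLike (WeightedCc ω μ) G ℝ := inferInstanceAs (FunLike C_c(G, ℝ) G ℝ)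

variable {ω μ}

theorem ext {f g : WeightedCc ω μ} (h : ∀ s, f s = g s) : f = g := DFunLike.ext _ _ h

theorem continuous (f : WeightedCc ω μ) : Continuous f := ContinuousMap.continuous (CompactlySupportedContinuousMap.toContinuousMap f)

theorem hasCompactSupport (f : WeightedCc ω μ) : HasCompactSupport f :=
  CompactlySupportedContinuousMap.hasCompactSupport (f : C_c(G, ℝ))

@[simp] theorem add_apply (f g : WeightedCc ω μ) (s : G) : (f + g) s = f s + g s := rfl

@[simp] theorem neg_apply (f : WeightedCc ω μ) (s : G) : (-f) s = -f s := rfl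

@[simp] theorem zero_apply (s : G) : (0 : WeightedCc ω μ) s = 0 := rfl

@[simp] theorem smul_apply (c : ℝ) (f : WeightedCc ω μ) (s : G) : (c • f) s = c * f s := rfl

variable [IsTopologicalGroup G] [LocallyCompactSpace G] [BorelSpace G]
  [μ.IsHaarMeasure] [μ.Regular]

theorem integrable_abs (f : WeightedCc ω μ) : Integrable (fun s => |f s| * ω s) μ :=
  ω.integrable_mul μ f.continuous.abs (f.hasCompactSupport.comp_left abs_zero)

/-- The norm `‖f‖_{1,ω} = ∫ |f(s)| ω(s) ds` on `C_c(G)`. -/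
noncomputable instance : SeminormedAddCommGroup (WeightedCc ω μ) :=
  AddGroupSeminorm.toSeminormedAddCommGroup
    { toFun := fun f => ∫ s, |f s| * ω s ∂μ
      map_zero' := by simp
      neg' := fun f => by simp
      add_le' := fun f g => by
        rw [← integral_add f.integrable_abs g.integrable_abs]
        refine integral_mono (f + g).integrable_abs
          (f.integrable_abs.add g.integrable_abs) fun s => ?_
        have := mul_le_mul_of_nonneg_right (abs_add_le (f s) (g s)) (ω.nonneg s)
        simpa [add_mul] using this }

theorem norm_def (f : WeightedCc ω μ) : ‖f‖ = ∫ s, |f s| * ω s ∂μ := rfl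

noncomputable instance : NormedSpace ℝ (WeightedCc ω μ) where
  norm_smul_le c f := by
    simp only [norm_def, smul_apply, abs_mul, mul_assoc, Real.norm_eq_abs]
    rw [integral_const_mul]



/-- The convolution `(f * g)(s) = ∫ f(r) g(r⁻¹ s) dr` on `C_c(G)`. -/
noncomputable def conv (f g : WeightedCc ω μ) : WeightedCc ω μ :=
  (⟨⟨fun s => ∫ r, f r * g (r⁻¹ * s) ∂μ, by
    have hf := f.continuous
    have hg := g.continuous
    have h : ContinuousOn (fun s => ∫ r, f r * g (r⁻¹ * s) ∂μ) Set.univ := by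
      refine continuousOn_integral_of_compact_support f.hasCompactSupport (by fun_prop) ?_
      intro p x _ hx
      simp [image_eq_zero_of_notMem_tsupport hx]
    exact continuousOn_univ.1 h⟩, by
    refine HasCompactSupport.intro
      (K := tsupport f * tsupport g) (IsCompact.mul f.hasCompactSupport g.hasCompactSupport)
      fun s hs => ?_
    refine integral_eq_zero_of_ae (ae_of_all _ fun r => ?_)
    by_contra hne
    obtain ⟨h1, h2⟩ := mul_ne_zero_iff.1 hne
    exact hs ⟨r, subset_tsupport _ h1, r⁻¹ * s, subset_tsupport _ h2, by simp⟩⟩ : C_c(G, ℝ))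

theorem conv_apply (f g : WeightedCc ω μ) (s : G) :
    conv f g s = ∫ r, f r * g (r⁻¹ * s) ∂μ := rfl

theorem integrable_conv (f g : WeightedCc ω μ) (s : G) :
    Integrable (fun r => f r * g (r⁻¹ * s)) μ := by
  have hf := f.continuous
  have hg := g.continuous
  exact Continuous.integrable_of_hasCompactSupport (by fun_prop) f.hasCompactSupport.mul_right

/-- The weighted norm is submultiplicative for convolution. -/
theorem norm_conv_le (f g : WeightedCc ω μ) : ‖conv f g‖ ≤ ‖f‖ * ‖g‖ := by
  let ν : Measure G := μ.withDensity fun s => ENNReal.ofReal (ω s)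
  have hωm : Measurable fun s => ENNReal.ofReal (ω s) := ω.measurable.ennreal_ofReal
  have hint : ∀ h : G → ℝ, ∫ s, h s ∂ν = ∫ s, h s * ω s ∂μ := fun h => by
    rw [integral_withDensity_eq_integral_toReal_smul hωm (by simp)]
    simp [ENNReal.toReal_ofReal (ω.nonneg _), mul_comm]
  have : IsFiniteMeasureOnCompacts ν := ⟨fun K hK => by
    obtain ⟨b, hb⟩ := ω.exists_bound μ hK.closure
    calc ν K ≤ ν (closure K) := measure_mono subset_closure
      _ = ∫⁻ s in closure K, ENNReal.ofReal (ω s) ∂μ :=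
        withDensity_apply _ isClosed_closure.measurableSet
      _ ≤ ∫⁻ _ in closure K, ENNReal.ofReal b ∂μ :=
        setLIntegral_mono measurable_const fun s hs => ENNReal.ofReal_le_ofReal (hb s hs)
      _ = ENNReal.ofReal b * μ (closure K) := setLIntegral_const _ _
      _ < ⊤ := ENNReal.mul_lt_top ENNReal.ofReal_lt_top hK.closure.measure_lt_top⟩
  have hf := f.continuous
  have hg := g.continuous
  let f' : WeightedCc ω μ :=
    (⟨⟨fun s => |f s|, hf.abs⟩, f.hasCompactSupport.comp_left abs_zero⟩ : C_c(G, ℝ))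
  let g' : WeightedCc ω μ :=
    (⟨⟨fun s => |g s|, hg.abs⟩, g.hasCompactSupport.comp_left abs_zero⟩ : C_c(G, ℝ))
  let F : G → G → ℝ := fun r s => |f r| * |g (r⁻¹ * s)|
  have hF : Continuous F.uncurry := by
    simp only [F, Function.uncurry_def]
    fun_prop
  have hFc : HasCompactSupport F.uncurry := by
    refine HasCompactSupport.intro (K := tsupport f ×ˢ (tsupport f * tsupport g))
      (f.hasCompactSupport.isCompact.prod
        (IsCompact.mul f.hasCompactSupport g.hasCompactSupport)) fun p hp => ?_
    by_contra hne
    obtain ⟨h1, h2⟩ := mul_ne_zero_iff.1 hne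
    have h1' := subset_tsupport _ (abs_ne_zero.1 h1)
    exact hp ⟨h1', p.1, h1', p.1⁻¹ * p.2, subset_tsupport _ (abs_ne_zero.1 h2), by simp⟩
  have hswap := integral_integral_swap_of_hasCompactSupport hF hFc (μ := μ) (ν := ν)
  have h1 : ‖conv f g‖ ≤ ∫ s, (∫ r, F r s ∂μ) ∂ν := by
    rw [norm_def, ← hint]
    refine integral_mono_of_nonneg (ae_of_all _ fun s => abs_nonneg _) ?_
      (ae_of_all _ fun s => ?_)
    · exact (conv f' g').continuous.integrable_of_hasCompactSupport (conv f' g').hasCompactSupport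
    · refine (norm_integral_le_integral_norm (fun r => f r * g (r⁻¹ * s))).trans (le_of_eq ?_)
      simp [F]
  have h2 : ∀ r, ∫ s, F r s ∂ν ≤ |f r| * ω r * ‖g‖ := by
    intro r
    have : ∫ s, F r s ∂ν = |f r| * ∫ s, |g s| * ω (r * s) ∂μ := by
      rw [hint, ← integral_mul_left_eq_self (μ := μ) (fun s => F r s * ω s) r, ← integral_const_mul]
      simp [F, mul_assoc]
    rw [this, mul_assoc]
    refine mul_le_mul_of_nonneg_left ?_ (abs_nonneg _)
    rw [norm_def, ← integral_const_mul]
    refine integral_mono_of_nonneg (ae_of_all _ fun s => mul_nonneg (abs_nonneg _) (ω.nonneg _))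
      (g.integrable_abs.const_mul _) (ae_of_all _ fun s => ?_)
    have := mul_le_mul_of_nonneg_left (ω.submul r s) (abs_nonneg (g s))
    simp only
    linarith
  calc ‖conv f g‖ ≤ ∫ r, (∫ s, F r s ∂ν) ∂μ := hswap ▸ h1
    _ ≤ ∫ r, |f r| * ω r * ‖g‖ ∂μ := by
        refine integral_mono_of_nonneg
          (ae_of_all _ fun r => integral_nonneg fun s => by positivity)
          (f.integrable_abs.mul_const _) (ae_of_all _ h2)
    _ = ‖f‖ * ‖g‖ := by rw [integral_mul_const, norm_def f]

end WeightedCc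

/-- The Beurling algebra `L¹(G, ω)`, as the completion of `C_c(G)` for the norm
`‖f‖_{1,ω} = ∫ |f(s)| ω(s) ds`. -/
abbrev BeurlingAlgebra [IsTopologicalGroup G] [LocallyCompactSpace G] [BorelSpace G]
    (ω : Weight G) (μ : Measure G) [μ.IsHaarMeasure] [μ.Regular] : Type _ :=
  Completion (WeightedCc ω μ)

namespace BeurlingAlgebra

variable [IsTopologicalGroup G] [LocallyCompactSpace G] [BorelSpace G]
  (ω : Weight G) (μ : Measure G) [μ.IsHaarMeasure] [μ.Regular]

/-- The canonical map `C_c(G) → L¹(G, ω)`. -/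
noncomputable def ofCc (f : C_c(G, ℝ)) : BeurlingAlgebra ω μ :=
  ((show WeightedCc ω μ from f : WeightedCc ω μ) : Completion (WeightedCc ω μ))

variable {ω μ} in
/-- Convolution on `C_c(G)` as a bounded bilinear map with values in `L¹(G, ω)`. -/
noncomputable def convL : WeightedCc ω μ →L[ℝ] WeightedCc ω μ →L[ℝ] BeurlingAlgebra ω μ :=
  LinearMap.mkContinuous₂
    (LinearMap.mk₂ ℝ (fun f g => (WeightedCc.conv f g : Completion (WeightedCc ω μ)))
      (fun f f' g => by
        rw [← Completion.coe_add]
        refine congrArg _ (WeightedCc.ext fun s => ?_)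
        simp only [WeightedCc.conv_apply, WeightedCc.add_apply, add_mul]
        exact integral_add (f.integrable_conv g s) (f'.integrable_conv g s))
      (fun c f g => by
        rw [← Completion.coe_smul]
        refine congrArg _ (WeightedCc.ext fun s => ?_)
        simp only [WeightedCc.conv_apply, WeightedCc.smul_apply, mul_assoc]
        exact integral_const_mul _ _)
      (fun f g g' => by
        rw [← Completion.coe_add]
        refine congrArg _ (WeightedCc.ext fun s => ?_)
        simp only [WeightedCc.conv_apply, WeightedCc.add_apply, mul_add]
        exact integral_add (f.integrable_conv g s) (f.integrable_conv g' s))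
      (fun c f g => by
        rw [← Completion.coe_smul]
        refine congrArg _ (WeightedCc.ext fun s => ?_)
        simp only [WeightedCc.conv_apply, WeightedCc.smul_apply, mul_left_comm _ c]
        exact integral_const_mul _ _))
    1 (fun f g => by simpa using WeightedCc.norm_conv_le f g)

variable {ω μ} in
/-- The continuous bilinear extension of convolution from `C_c(G)` to `L¹(G, ω)`. -/
noncomputable def mulL :
    BeurlingAlgebra ω μ →L[ℝ] BeurlingAlgebra ω μ →L[ℝ] BeurlingAlgebra ω μ :=
  (((convL (ω := ω) (μ := μ)).extend Completion.toComplL).flip.extend Completion.toComplL).flip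

/-- The multiplication of `L¹(G, ω)`. -/
noncomputable instance : Mul (BeurlingAlgebra ω μ) := ⟨fun f g => mulL f g⟩

variable {ω μ} in
/-- On `C_c(G)` the multiplication of `L¹(G, ω)` is convolution. -/
theorem coe_mul_coe (f g : WeightedCc ω μ) :
    (f : BeurlingAlgebra ω μ) * (g : BeurlingAlgebra ω μ) =
      ((WeightedCc.conv f g : WeightedCc ω μ) : BeurlingAlgebra ω μ) := by
  have hd : DenseRange (Completion.toComplL (𝕜 := ℝ) (E := WeightedCc ω μ)) :=
    Completion.denseRange_coe
  have hu : IsUniformInducing (Completion.toComplL (𝕜 := ℝ) (E := WeightedCc ω μ)) :=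
    Completion.isUniformInducing_coe _
  change mulL (Completion.toComplL (𝕜 := ℝ) f) (Completion.toComplL (𝕜 := ℝ) g) = _
  rw [mulL, ContinuousLinearMap.flip_apply, ContinuousLinearMap.extend_eq _ hd hu,
    ContinuousLinearMap.flip_apply, ContinuousLinearMap.extend_eq _ hd hu]
  rfl

/-- The cone of `L¹(G, ω)`: the closure of the nonnegative functions in `C_c(G)`. -/
def positiveCone : Set (BeurlingAlgebra ω μ) :=
  closure (ofCc ω μ '' {f | ∀ s, 0 ≤ f s})

end BeurlingAlgebra

/-- The left translate `f(s⁻¹ ·)` of `f ∈ C_c(G)`. -/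
def leftTranslate [IsTopologicalGroup G] (s : G) (f : C_c(G, ℝ)) : C_c(G, ℝ) where
  toFun t := f (s⁻¹ * t)
  continuous_toFun := by fun_prop
  hasCompactSupport' := f.hasCompactSupport.comp_homeomorph (Homeomorph.mulLeft s⁻¹)

variable {X : Type*} [NormedAddCommGroup X] [NormedSpace ℝ X]

/-- A positive strongly continuous representation `U` of `G` on `X`, pre-ordered by the cone `C`,
such that `‖U_r‖ ≤ c ω(r)` for some constant `c ≥ 0` and all `r`. -/
structure PositiveGroupRep (ω : Weight G) (C : PointedCone ℝ X) where
  /-- The group homomorphism into the invertible bounded operators. -/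
  toHom : G →* (X →L[ℝ] X)ˣ
  map_mem : ∀ r, ∀ x ∈ C, (toHom r : X →L[ℝ] X) x ∈ C
  inv_map_mem : ∀ r, ∀ x ∈ C, (((toHom r)⁻¹ : (X →L[ℝ] X)ˣ) : X →L[ℝ] X) x ∈ C
  strongly_continuous : ∀ x, Continuous fun r => (toHom r : X →L[ℝ] X) x
  bounded : ∃ c : ℝ, 0 ≤ c ∧ ∀ r, ‖(toHom r : X →L[ℝ] X)‖ ≤ c * ω r

/-- The operator `U_r` of a positive group representation. -/
def PositiveGroupRep.op {ω : Weight G} {C : PointedCone ℝ X} (U : PositiveGroupRep ω C) (r : G) :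
    X →L[ℝ] X := U.toHom r

/-- A positive non-degenerate bounded representation `T : L¹(G, ω) → B(X)` on `X`, pre-ordered by
the cone `C`. -/
structure PositiveAlgebraRep [IsTopologicalGroup G] [LocallyCompactSpace G] [BorelSpace G]
    (ω : Weight G) (μ : Measure G) [μ.IsHaarMeasure] [μ.Regular] (C : PointedCone ℝ X) where
  /-- The bounded linear map underlying the representation. -/
  toCLM : BeurlingAlgebra ω μ →L[ℝ] (X →L[ℝ] X)
  map_mul : ∀ f g, toCLM (f * g) = toCLM f * toCLM g
  map_mem : ∀ f ∈ BeurlingAlgebra.positiveCone ω μ, ∀ x ∈ C, toCLM f x ∈ C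
  nondegenerate : Dense (Submodule.span ℝ {y : X | ∃ f x, y = toCLM f x} : Set X)

/-- A neighbourhood base of `e` of which all elements are contained in a fixed compact set. -/
def IsCompactlyBoundedBase (𝒵 : Set (Set G)) : Prop :=
  (𝓝 (1 : G)).HasBasis (· ∈ 𝒵) id ∧ ∃ K : Set G, IsCompact K ∧ ∀ V ∈ 𝒵, V ⊆ K

/-- The number `inf_{W ∈ 𝒵} sup_{r ∈ W} ω(r)`. -/
noncomputable def Weight.infSup (ω : Weight G) (𝒵 : Set (Set G)) : ℝ :=
  ⨅ W : 𝒵, ⨆ r : (W : Set G), ω r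

end Beurling

/-! ### Integrals in closed cones and pointwise limits of bounded families of operators. -/

section General

/-! Write λ_r f = f(r⁻¹ ·). Both directions rest on the covariance relation U_s T(f) = T(λ_s f) and
on the formula f * g = ∫ f(r) λ_r g dr, a Bochner integral in L¹(G, ω) (`ofCc_mul_ofCc`). Given U,
left invariance of Haar measure yields covariance for its integrated form. Applying T to the formula
for f * g then gives T(f * g) = T(f) T(g), and an approximate identity gives nondegeneracy. Given T,
the operators T(λ_s z_V) are eventually uniformly bounded, and T(λ_s z_V) T(f) = T(λ_s z_V * f)
tends to T(λ_s f). Since the vectors T(f)x have dense span, the strong limit U_s exists, satisfies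
covariance and does not depend on the approximate identity. The homomorphism property, strong
continuity and T^{U^T} = T are checked on these vectors; positivity passes to the limit because the
cone is closed. That U^T recovers U from its integrated form is uniqueness of limits. Every norm
bound carries sup_V ω as an explicit factor. This factor can be brought down to 1 when ω is
normalized near e, which gives the sharp norm statements. -/

/-- The integral of a continuous compactly supported function with values in a closed cone lies in
the cone. -/
theorem PointedCone.integral_mem_of_hasCompactSupport {G : Type*} [TopologicalSpace G]
    [R1Space G] [MeasurableSpace G] [BorelSpace G] {μ : Measure G} [IsFiniteMeasureOnCompacts μ]
    {X : Type*} [NormedAddCommGroup X] [NormedSpace ℝ X] [CompleteSpace X]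
    (C : PointedCone ℝ X) (hC : IsClosed (C : Set X)) {F : G → X} (hF : Continuous F)
    (hc : HasCompactSupport F) (hm : ∀ r, F r ∈ C) : ∫ r, F r ∂μ ∈ C := by
  rw [← setIntegral_eq_integral_of_forall_compl_eq_zero (s := tsupport F)
    fun x hx => image_eq_zero_of_notMem_tsupport hx]
  by_cases h0 : μ (tsupport F) = 0
  · rw [Measure.restrict_eq_zero.2 h0, integral_zero_measure]
    exact C.zero_mem
  have hfin : μ (tsupport F) ≠ ⊤ := hc.measure_lt_top.ne
  -- The average over a set of positive finite measure stays in a closed convex set, and the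
  -- integral is a nonnegative multiple of it.
  have := (PointedCone.convex C).set_average_mem hC h0 hfin
    (ae_of_all _ hm) (hF.integrable_of_hasCompactSupport hc).integrableOn
  rw [setAverage_eq] at this
  have h2 := C.smul_mem (measureReal_nonneg (μ := μ) (s := tsupport F)) this
  have hne : μ.real (tsupport F) ≠ 0 := (ENNReal.toReal_pos h0 hfin).ne'
  rwa [smul_inv_smul₀ hne] at h2

variable {X Y : Type*} [NormedAddCommGroup X] [NormedSpace ℝ X] [NormedAddCommGroup Y]
  [NormedSpace ℝ Y]

/-- A uniformly bounded family of operators which converges pointwise to an operator on a set with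
dense span converges pointwise everywhere. -/
theorem ContinuousLinearMap.tendsto_of_dense_span {ι : Type*} {l : Filter ι} {A : ι → X →L[ℝ] Y}
    {B : X →L[ℝ] Y} {M : ℝ} (hM : ∀ᶠ i in l, ‖A i‖ ≤ M) {D : Set X}
    (hD : Dense (Submodule.span ℝ D : Set X)) (hA : ∀ y ∈ D, Tendsto (A · y) l (𝓝 (B y)))
    (x : X) : Tendsto (A · x) l (𝓝 (B x)) := by
  have hspan : ∀ y ∈ Submodule.span ℝ D, Tendsto (A · y) l (𝓝 (B y)) := by
    intro y hy
    induction hy using Submodule.span_induction with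
    | mem y hy => exact hA y hy
    | zero => simpa using tendsto_const_nhds
    | add y y' _ _ h h' => simpa using h.add h'
    | smul c y _ h => simpa using h.const_smul c
  rw [Metric.tendsto_nhds]
  intro ε hε
  have hM' : 0 < |M| + ‖B‖ + 1 := by positivity
  -- Replacing x by y costs at most (|M| + ‖B‖) ‖x - y‖ < ε / 2. The absolute value is there because
  -- `M` may be negative if `l` is trivial.
  obtain ⟨y, hy, hxy⟩ := hD.exists_dist_lt x (show 0 < ε / 2 / (|M| + ‖B‖ + 1) by positivity)
  rw [lt_div_iff₀ hM', dist_eq_norm] at hxy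
  filter_upwards [hM, Metric.tendsto_nhds.1 (hspan y hy) (ε / 2) (half_pos hε)] with i hi hiy
  rw [dist_eq_norm] at hiy ⊢
  have h1 : A i x - B x = A i (x - y) + (A i y - B y) - B (x - y) := by simp
  have h2 : ‖A i (x - y)‖ ≤ |M| * ‖x - y‖ := (A i).le_of_opNorm_le (hi.trans (le_abs_self M)) _
  have h3 := B.le_opNorm (x - y)
  have h4 := norm_sub_le (A i (x - y) + (A i y - B y)) (B (x - y))
  have h5 := norm_add_le (A i (x - y)) (A i y - B y)
  rw [h1]
  nlinarith [norm_nonneg (x - y)]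

/-- A uniformly bounded family of operators which converges pointwise on a set with dense span
converges pointwise to an operator. -/
theorem ContinuousLinearMap.exists_tendsto_of_dense_span [CompleteSpace Y] {ι : Type*}
    {l : Filter ι} [l.NeBot]
    {A : ι → X →L[ℝ] Y} {M : ℝ} (hM : ∀ᶠ i in l, ‖A i‖ ≤ M) {D : Set X}
    (hD : Dense (Submodule.span ℝ D : Set X)) (hA : ∀ y ∈ D, ∃ w, Tendsto (A · y) l (𝓝 w)) :
    ∃ B : X →L[ℝ] Y, ∀ x, Tendsto (A · x) l (𝓝 (B x)) := by
  have hspan : ∀ y ∈ Submodule.span ℝ D, ∃ w, Tendsto (A · y) l (𝓝 w) := by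
    intro y hy
    induction hy using Submodule.span_induction with
    | mem y hy => exact hA y hy
    | zero => exact ⟨0, by simp⟩
    | add y y' _ _ h h' =>
      obtain ⟨w, h⟩ := h
      obtain ⟨w', h'⟩ := h'
      exact ⟨w + w', by simpa using h.add h'⟩
    | smul c y _ h =>
      obtain ⟨w, h⟩ := h
      exact ⟨c • w, by simpa using h.const_smul c⟩
  have hall : ∀ x, ∃ w, Tendsto (A · x) l (𝓝 w) := by
    intro x
    -- At x only the Cauchy property is available: eventually A i x is within ε / 2 of the limit at
    -- a nearby y in the span.
    suffices h : Cauchy (map (A · x) l) from CompleteSpace.complete h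
    refine Metric.cauchy_iff.2 ⟨inferInstance, fun ε hε => ?_⟩
    have hM' : 0 < |M| + 1 := by positivity
    obtain ⟨y, hy, hxy⟩ := hD.exists_dist_lt x (show 0 < ε / 4 / (|M| + 1) by positivity)
    rw [lt_div_iff₀ hM', dist_eq_norm] at hxy
    obtain ⟨w, hw⟩ := hspan y hy
    have hev : ∀ᶠ i in l, dist (A i x) w < ε / 2 := by
      filter_upwards [hM, Metric.tendsto_nhds.1 hw (ε / 4) (by positivity)] with i hi hiy
      rw [dist_eq_norm] at hiy ⊢
      have h1 : A i x - w = A i (x - y) + (A i y - w) := by simp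
      have h2 : ‖A i (x - y)‖ ≤ |M| * ‖x - y‖ := (A i).le_of_opNorm_le (hi.trans (le_abs_self M)) _
      have h5 := norm_add_le (A i (x - y)) (A i y - w)
      rw [h1]
      nlinarith [norm_nonneg (x - y)]
    refine ⟨Metric.ball w (ε / 2), hev, fun a ha b hb => ?_⟩
    rw [Metric.mem_ball] at ha hb
    have := dist_triangle_right a b w
    linarith
  choose B hB using hall
  refine ⟨LinearMap.mkContinuous
    { toFun := B
      map_add' := fun x y => tendsto_nhds_unique (hB _) (by simpa using (hB x).add (hB y))
      map_smul' := fun c x =>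
        tendsto_nhds_unique (hB _) (by simpa using (hB x).const_smul c) } M fun x => ?_, hB⟩
  exact le_of_tendsto (hB x).norm (hM.mono fun i hi => (A i).le_of_opNorm_le hi x)

end General

section LeftTranslate

variable {G : Type*} [Group G] [TopologicalSpace G] [IsTopologicalGroup G]

theorem leftTranslate_apply (s : G) (f : C_c(G, ℝ)) (t : G) :
    leftTranslate s f t = f (s⁻¹ * t) := rfl

theorem leftTranslate_one (f : C_c(G, ℝ)) : leftTranslate 1 f = f := by
  ext t
  simp [leftTranslate_apply]

theorem leftTranslate_mul (s t : G) (f : C_c(G, ℝ)) :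
    leftTranslate (s * t) f = leftTranslate s (leftTranslate t f) := by
  ext r
  simp [leftTranslate_apply, mul_assoc]

end LeftTranslate

theorem CompactlySupportedContinuousMap.integrable_smul {G : Type*} [TopologicalSpace G]
    [MeasurableSpace G] [OpensMeasurableSpace G] {μ : Measure G} [IsFiniteMeasureOnCompacts μ]
    {E : Type*} [NormedAddCommGroup E] [NormedSpace ℝ E] (f : C_c(G, ℝ)) {F : G → E} (hF : Continuous F) :
    Integrable (fun r => f r • F r) μ :=
  (f.continuous.smul hF).integrable_of_hasCompactSupport f.hasCompactSupport.smul_right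

/-! ### Approximate identities in C_c(G). -/

section ApproximateIdentity

variable {G : Type*} [Group G] [TopologicalSpace G] [MeasurableSpace G]

/-- A family of nonnegative functions in `C_c(G)` with integral one, the supports of which shrink
to the identity along a filter. -/
structure IsApproximateIdentity (μ : Measure G) {ι : Type*} (l : Filter ι) (z : ι → C_c(G, ℝ)) :
    Prop where
  nonneg : ∀ i s, 0 ≤ z i s
  integral_eq_one : ∀ᶠ i in l, ∫ r, z i r ∂μ = 1
  support_subset : ∀ V ∈ 𝓝 (1 : G), ∀ᶠ i in l, Function.support (z i) ⊆ V

/-- Functions supported in the members of a neighbourhood base of the identity form an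
approximate identity. -/
theorem IsCompactlyBoundedBase.isApproximateIdentity {μ : Measure G} {𝒵 : Set (Set G)}
    (h𝒵 : IsCompactlyBoundedBase 𝒵) {z : 𝒵 → C_c(G, ℝ)} (h0 : ∀ V s, 0 ≤ z V s)
    (hs : ∀ V, Function.support (z V) ⊆ (V : Set G)) (h1 : ∀ V, ∫ r, z V r ∂μ = 1) :
    IsApproximateIdentity μ atBot z where
  nonneg := h0
  integral_eq_one := .of_forall h1
  support_subset V hV := by
    obtain ⟨W, hW, hWV⟩ := h𝒵.1.mem_iff.1 hV
    filter_upwards [eventually_le_atBot (⟨W, hW⟩ : 𝒵)] with W' hW'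
    exact (hs W').trans (le_trans (show (W' : Set G) ⊆ W from hW') hWV)

variable [IsTopologicalGroup G] [LocallyCompactSpace G] [BorelSpace G]
  {μ : Measure G} [μ.IsHaarMeasure]

variable (μ) in
theorem exists_bump_of_mem_nhds_one {V : Set G} (hV : V ∈ 𝓝 (1 : G)) :
    ∃ f : C_c(G, ℝ), (∀ s, 0 ≤ f s) ∧ ∫ r, f r ∂μ = 1 ∧ Function.support f ⊆ V := by
  -- G is not assumed Hausdorff here, so Urysohn's lemma is applied to the closure of {1}, which is
  -- compact and still inside the interior of V.
  have hdisj : Disjoint (closure {(1 : G)}) (interior V)ᶜ := by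
    rw [Set.disjoint_compl_right_iff_subset]
    exact isCompact_singleton.closure_subset_of_isOpen isOpen_interior
      (Set.singleton_subset_iff.2 (mem_interior_iff_mem_nhds.2 hV))
  obtain ⟨f, hf1, hf0, hfc, hf⟩ := exists_continuous_one_zero_of_isCompact
    isCompact_singleton.closure isOpen_interior.isClosed_compl hdisj
  have hpos : 0 < ∫ r, f r ∂μ := f.continuous.integral_pos_of_hasCompactSupport_nonneg_nonzero hfc
    (fun r => (hf r).1) (x := 1) (by rw [hf1 (subset_closure rfl)]; simp)
  refine ⟨(∫ r, f r ∂μ)⁻¹ • (⟨f, hfc⟩ : C_c(G, ℝ)), fun s => ?_, ?_, ?_⟩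
  · exact mul_nonneg (inv_nonneg.2 hpos.le) (hf s).1
  · change ∫ r, (∫ r, f r ∂μ)⁻¹ * f r ∂μ = 1
    rw [integral_const_mul, inv_mul_cancel₀ hpos.ne']
  · intro s hs
    by_contra hsV
    refine hs ?_
    change (∫ r, f r ∂μ)⁻¹ * f s = 0
    rw [hf0 fun h => hsV (interior_subset h)]
    simp

variable (μ) in
open Classical in
/-- A family of functions in `C_c(G)` indexed by sets: `bump V` is supported in `V` if `V` is a
neighbourhood of the identity. -/
noncomputable def bump (V : Set G) : C_c(G, ℝ) :=
  if hV : V ∈ 𝓝 (1 : G) then (exists_bump_of_mem_nhds_one μ hV).choose else 0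

-- This is a reference approximate identity, independent of any chosen base. The principal filter
-- discards small sets that are not neighbourhoods of 1, on which `bump` is zero and has no unit
-- mass.
variable (μ) in
theorem isApproximateIdentity_bump :
    IsApproximateIdentity μ ((𝓝 (1 : G)).smallSets ⊓ 𝓟 {V | V ∈ 𝓝 (1 : G)}) (bump μ) where
  nonneg V s := by
    unfold bump
    split_ifs with hV
    · exact (exists_bump_of_mem_nhds_one μ hV).choose_spec.1 s
    · exact le_rfl
  integral_eq_one := by
    rw [eventually_inf_principal]
    filter_upwards with V hV
    rw [bump, dif_pos hV]
    exact (exists_bump_of_mem_nhds_one μ hV).choose_spec.2.1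
  support_subset V hV := by
    rw [eventually_inf_principal]
    filter_upwards [eventually_smallSets_subset.2 hV] with W hWV hW
    rw [bump, dif_pos hW]
    exact (exists_bump_of_mem_nhds_one μ hW).choose_spec.2.2.trans hWV

instance : ((𝓝 (1 : G)).smallSets ⊓ 𝓟 {V | V ∈ 𝓝 (1 : G)}).NeBot := by
  refine inf_principal_neBot_iff.2 fun S hS => ?_
  obtain ⟨V, hV, hVS⟩ := (𝓝 (1 : G)).basis_sets.smallSets.mem_iff.1 hS
  exact ⟨V, hVS (Set.mem_powerset subset_rfl), hV⟩

variable {ι : Type*} {l : Filter ι} {z : ι → C_c(G, ℝ)}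
  {E : Type*} [NormedAddCommGroup E] [NormedSpace ℝ E]

namespace IsApproximateIdentity

omit [IsTopologicalGroup G] [LocallyCompactSpace G] in
theorem tendsto_integral [CompleteSpace E] (hz : IsApproximateIdentity μ l z) {F : G → E}
    (hF : Continuous F) : Tendsto (fun i => ∫ r, z i r • F r ∂μ) l (𝓝 (F 1)) := by
  rw [Metric.tendsto_nhds]
  intro ε hε
  have hV := Metric.continuousAt_iff'.1 (hF.continuousAt (x := 1)) (ε / 2) (half_pos hε)
  filter_upwards [hz.integral_eq_one, hz.support_subset _ hV] with i hi1 hi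
  -- Unit mass moves F 1 under the integral, where only values of F near 1 matter.
  have h1 : ∫ r, z i r • F r ∂μ - F 1 = ∫ r, z i r • (F r - F 1) ∂μ := by
    simp_rw [smul_sub]
    rw [integral_sub ((z i).integrable_smul hF)
      ((z i).integrable_smul continuous_const), integral_smul_const, hi1, one_smul]
  rw [dist_eq_norm, h1]
  have h2 : ‖∫ r, z i r • (F r - F 1) ∂μ‖ ≤ ∫ r, z i r * (ε / 2) ∂μ := by
    refine norm_integral_le_of_norm_le
      ((z i).integrable_smul (continuous_const (y := ε / 2))) (ae_of_all _ fun r => ?_)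
    rw [norm_smul, Real.norm_of_nonneg (hz.nonneg i r)]
    by_cases hr : r ∈ Function.support (z i)
    · have := hi hr
      rw [Set.mem_ofPred_eq, dist_eq_norm] at this
      exact mul_le_mul_of_nonneg_left this.le (hz.nonneg i r)
    · simp [Function.notMem_support.1 hr]
  rw [integral_mul_const, hi1, one_mul] at h2
  linarith

omit [LocallyCompactSpace G] in
theorem tendsto_integral_leftTranslate [CompleteSpace E] (hz : IsApproximateIdentity μ l z)
    {F : G → E} (hF : Continuous F) (s : G) :
    Tendsto (fun i => ∫ r, leftTranslate s (z i) r • F r ∂μ) l (𝓝 (F s)) := by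
  have h := hz.tendsto_integral (hF.comp (continuous_const_mul s))
  simp only [Function.comp_apply, mul_one] at h
  convert h using 2 with i
  rw [← integral_mul_left_eq_self (μ := μ) (fun r => leftTranslate s (z i) r • F r) s]
  simp [leftTranslate_apply]

end IsApproximateIdentity

end ApproximateIdentity

/-! ### Strict positivity of the weight, and the measure ω dμ. -/

namespace Weight

section

variable {G : Type*} [Group G] [MeasurableSpace G] (ω : Weight G)

/-- A zero at s would force ω(t) ≤ ω(ts⁻¹) ω(s) = 0 for every t. -/
theorem pos (s : G) : 0 < ω s := by
  obtain ⟨t, ht⟩ := ω.nonzero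
  refine (ω.nonneg s).lt_of_ne fun h => ht (le_antisymm ?_ (ω.nonneg t))
  simpa [← h] using ω.submul (t * s⁻¹) s

/-- The measure `ω dμ`. -/
noncomputable def measure (μ : Measure G) : Measure G :=
  μ.withDensity fun s => ENNReal.ofReal (ω s)

theorem integral_measure (μ : Measure G) (h : G → ℝ) :
    ∫ s, h s ∂ω.measure μ = ∫ s, h s * ω s ∂μ := by
  rw [measure, integral_withDensity_eq_integral_toReal_smul ω.measurable.ennreal_ofReal (by simp)]
  simp [ENNReal.toReal_ofReal (ω.nonneg _), mul_comm]

end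

variable {G : Type*} [Group G] [TopologicalSpace G] [IsTopologicalGroup G] [LocallyCompactSpace G]
  [MeasurableSpace G] [BorelSpace G] (ω : Weight G) (μ : Measure G) [μ.IsHaarMeasure] [μ.Regular]

instance : IsFiniteMeasureOnCompacts (ω.measure μ) := ⟨fun K hK => by
  obtain ⟨b, hb⟩ := ω.exists_bound μ hK.closure
  calc ω.measure μ K ≤ ω.measure μ (closure K) := measure_mono subset_closure
    _ = ∫⁻ s in closure K, ENNReal.ofReal (ω s) ∂μ :=
      withDensity_apply _ isClosed_closure.measurableSet
    _ ≤ ∫⁻ _ in closure K, ENNReal.ofReal b ∂μ :=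
      setLIntegral_mono measurable_const fun s hs => ENNReal.ofReal_le_ofReal (hb s hs)
    _ = ENNReal.ofReal b * μ (closure K) := setLIntegral_const _ _
    _ < ⊤ := ENNReal.mul_lt_top ENNReal.ofReal_lt_top hK.closure.measure_lt_top⟩

theorem exists_bound_nhds_one (μ : Measure G) [μ.IsHaarMeasure] [μ.Regular] :
    ∃ V ∈ 𝓝 (1 : G), ∃ b : ℝ, ∀ s ∈ V, ω s ≤ b := by
  obtain ⟨K, hK, hK1⟩ := exists_compact_mem_nhds (1 : G)
  exact ⟨K, hK1, ω.exists_bound μ hK⟩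

end Weight

/-! ### Translation and convolution in L¹(G, ω). -/

namespace BeurlingAlgebra

variable {G : Type*} [Group G] [TopologicalSpace G] [IsTopologicalGroup G] [LocallyCompactSpace G]
  [MeasurableSpace G] [BorelSpace G] {ω : Weight G} {μ : Measure G} [μ.IsHaarMeasure] [μ.Regular]

theorem ofCc_sub (f g : C_c(G, ℝ)) : ofCc ω μ (f - g) = ofCc ω μ f - ofCc ω μ g :=
  Completion.coe_sub (α := WeightedCc ω μ) _ _

theorem denseRange_ofCc : DenseRange (ofCc ω μ) :=
  Completion.denseRange_coe (α := WeightedCc ω μ)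

theorem norm_ofCc (f : C_c(G, ℝ)) : ‖ofCc ω μ f‖ = ∫ s, |f s| * ω s ∂μ :=
  Completion.norm_coe (E := WeightedCc ω μ) _

theorem norm_ofCc_eq_integral_measure (f : C_c(G, ℝ)) :
    ‖ofCc ω μ f‖ = ∫ s, |f s| ∂ω.measure μ := by
  rw [norm_ofCc, ω.integral_measure]

theorem norm_ofCc_leftTranslate_le (s : G) (f : C_c(G, ℝ)) :
    ‖ofCc ω μ (leftTranslate s f)‖ ≤ ω s * ‖ofCc ω μ f‖ := by
  have hi : Integrable (fun r => |f r| * ω r) μ :=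
    ω.integrable_mul μ f.continuous.abs (f.hasCompactSupport.comp_left abs_zero)
  rw [norm_ofCc, norm_ofCc, ← integral_const_mul,
    ← integral_mul_left_eq_self (μ := μ) (fun r => |leftTranslate s f r| * ω r) s]
  refine integral_mono_of_nonneg (ae_of_all _ fun r => mul_nonneg (abs_nonneg _) (ω.nonneg _))
    (hi.const_mul _) (ae_of_all _ fun r => ?_)
  have := mul_le_mul_of_nonneg_left (ω.submul s r) (abs_nonneg (f r))
  simp only [leftTranslate_apply, inv_mul_cancel_left]
  linarith

/-- The norm of such an f is an average of ω over V. -/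
theorem norm_ofCc_le_of_support_subset {f : C_c(G, ℝ)} (h0 : ∀ s, 0 ≤ f s)
    (h1 : ∫ r, f r ∂μ = 1) {V : Set G} (hs : Function.support f ⊆ V) {b : ℝ}
    (hb : ∀ s ∈ V, ω s ≤ b) : ‖ofCc ω μ f‖ ≤ b := by
  have hint := f.continuous.integrable_of_hasCompactSupport f.hasCompactSupport (μ := μ)
  rw [norm_ofCc, ← one_mul b, ← h1, ← integral_mul_const]
  refine integral_mono_of_nonneg (ae_of_all _ fun r => mul_nonneg (abs_nonneg _) (ω.nonneg _))
    (hint.mul_const b) (ae_of_all _ fun r => ?_)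
  simp only [abs_of_nonneg (h0 r)]
  by_cases hr : r ∈ Function.support f
  · exact mul_le_mul_of_nonneg_left (hb r (hs hr)) (h0 r)
  · simp [Function.notMem_support.1 hr]

/-- Left translation is strongly continuous on `L¹(G, ω)`. -/
theorem continuous_ofCc_leftTranslate (f : C_c(G, ℝ)) :
    Continuous fun s => ofCc ω μ (leftTranslate s f) := by
  rw [continuous_iff_continuousAt]
  intro t
  obtain ⟨K, hK, hKt⟩ := exists_compact_mem_nhds t
  have hf := f.continuous
  have ht : t ∈ K := mem_of_mem_nhds hKt
  -- For s in K all translates are supported in the single compact set K · supp f, so the parametric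
  -- integral is continuous there.
  have hc : ContinuousOn (fun s => ∫ r, |f (s⁻¹ * r) - f (t⁻¹ * r)| ∂ω.measure μ) K := by
    refine continuousOn_integral_of_compact_support (hK.mul f.hasCompactSupport)
      (by fun_prop) fun s r hs hr => ?_
    have h : ∀ s ∈ K, f (s⁻¹ * r) = 0 := fun s hs => by
      by_contra hne
      exact hr ⟨s, hs, s⁻¹ * r, subset_tsupport _ hne, by simp⟩
    rw [h s hs, h t ht, sub_self, abs_zero]
  have hc' := (hc.continuousAt hKt).tendsto
  simp only [sub_self, abs_zero, integral_zero] at hc'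
  rw [ContinuousAt, tendsto_iff_norm_sub_tendsto_zero]
  refine hc'.congr fun s => ?_
  rw [← ofCc_sub, norm_ofCc_eq_integral_measure]
  rfl

theorem integrable_measure (f : C_c(G, ℝ)) : Integrable f (ω.measure μ) :=
  f.continuous.integrable_of_hasCompactSupport f.hasCompactSupport

variable (ω μ) in
/-- The isometric embedding of `C_c(G)`, with the weighted norm, into `L¹(ω dμ)`. -/
noncomputable def ccToL1 : WeightedCc ω μ →ₗᵢ[ℝ] Lp ℝ 1 (ω.measure μ) where
  toFun f := (integrable_measure (f : C_c(G, ℝ))).toL1 f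
  map_add' _ _ := rfl
  map_smul' _ _ := rfl
  norm_map' f :=
    ((L1.norm_of_fun_eq_integral_norm (integrable_measure (f : C_c(G, ℝ)))).trans
      (norm_ofCc_eq_integral_measure (ω := ω) (μ := μ) f).symm).trans
      (Completion.norm_coe (E := WeightedCc ω μ) f)

variable (ω μ) in
/-- The isometric embedding of `L¹(G, ω)` into `L¹(ω dμ)`. -/
noncomputable def toL1 : BeurlingAlgebra ω μ →L[ℝ] Lp ℝ 1 (ω.measure μ) :=
  (ccToL1 ω μ).toContinuousLinearMap.extend Completion.toComplL

theorem toL1_ofCc (f : C_c(G, ℝ)) : toL1 ω μ (ofCc ω μ f) = (integrable_measure f).toL1 f :=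
  ContinuousLinearMap.extend_eq (e := Completion.toComplL (𝕜 := ℝ) (E := WeightedCc ω μ))
    (ccToL1 ω μ).toContinuousLinearMap Completion.denseRange_coe
    (Completion.isUniformInducing_coe _) f

theorem norm_toL1 (a : BeurlingAlgebra ω μ) : ‖toL1 ω μ a‖ = ‖a‖ := by
  refine isClosed_property denseRange_ofCc
    (isClosed_eq (toL1 ω μ).continuous.norm continuous_norm) (fun f => ?_) a
  rw [toL1_ofCc, norm_ofCc_eq_integral_measure, L1.norm_of_fun_eq_integral_norm]
  rfl

theorem toL1_injective : Function.Injective (toL1 ω μ) :=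
  (AddMonoidHomClass.isometry_of_norm _ norm_toL1).injective

/-- The convolution product as a Bochner integral of left translates. -/
theorem ofCc_mul_ofCc (f g : C_c(G, ℝ)) :
    ofCc ω μ f * ofCc ω μ g = ∫ r, f r • ofCc ω μ (leftTranslate r g) ∂μ := by
  have hint := f.integrable_smul (μ := μ) (continuous_ofCc_leftTranslate (ω := ω) (μ := μ) g)
  let h : C_c(G, ℝ) := WeightedCc.conv (ω := ω) (μ := μ) f g
  have hmul : ofCc ω μ f * ofCc ω μ g = ofCc ω μ h := coe_mul_coe (ω := ω) (μ := μ) f g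
  rw [hmul]
  -- Elements of the completion have no pointwise values. In L¹(ω dμ) they are determined by their
  -- integrals over measurable sets S; each is a continuous functional, hence commutes with the
  -- Bochner integral, and the claim becomes Fubini.
  apply toL1_injective
  rw [← ContinuousLinearMap.integral_comp_comm _ hint, toL1_ofCc]
  have hint' := (toL1 ω μ).integrable_comp hint
  apply Lp.ext
  refine Integrable.ae_eq_of_forall_setIntegral_eq _ _ (L1.integrable_coeFn _)
    (L1.integrable_coeFn _) fun S hS _ => ?_
  let I : Lp ℝ 1 (ω.measure μ) →L[ℝ] ℝ :=
    { toFun := fun φ => ∫ s in S, φ s ∂ω.measure μ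
      map_add' := fun φ ψ => by
        rw [← integral_add (L1.integrable_coeFn φ).integrableOn (L1.integrable_coeFn ψ).integrableOn]
        exact integral_congr_ae (ae_restrict_of_ae (Lp.coeFn_add φ ψ))
      map_smul' := fun c φ => by
        rw [RingHom.id_apply, ← integral_smul]
        exact integral_congr_ae (ae_restrict_of_ae (Lp.coeFn_smul c φ))
      cont := continuous_setIntegral S }
  have hI : ∀ k : C_c(G, ℝ), I ((integrable_measure k).toL1 k) = ∫ s in S, k s ∂ω.measure μ :=
    fun k => integral_congr_ae (ae_restrict_of_ae (Integrable.coeFn_toL1 (integrable_measure k)))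
  change I _ = I _
  rw [← ContinuousLinearMap.integral_comp_comm _ hint', hI]
  have hf := f.continuous
  have hg := g.continuous
  -- Compact support replaces σ-finiteness of μ, which may fail.
  have hswap := integral_integral_swap_of_hasCompactSupport
    (f := fun r s => f r * g (r⁻¹ * s)) (μ := μ) (ν := (ω.measure μ).restrict S)
    (by simp only [Function.uncurry_def]; fun_prop) (by
      refine HasCompactSupport.intro (K := tsupport f ×ˢ (tsupport f * tsupport g))
        (f.hasCompactSupport.isCompact.prod
          (IsCompact.mul f.hasCompactSupport g.hasCompactSupport)) fun p hp => ?_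
      by_contra hne
      obtain ⟨h1, h2⟩ := mul_ne_zero_iff.1 hne
      have h1' := subset_tsupport _ h1
      exact hp ⟨h1', p.1, h1', p.1⁻¹ * p.2, subset_tsupport _ h2, by simp⟩)
  calc ∫ s in S, h s ∂ω.measure μ = ∫ s in S, (∫ r, f r * g (r⁻¹ * s) ∂μ) ∂ω.measure μ := rfl
    _ = ∫ r, (∫ s in S, f r * g (r⁻¹ * s) ∂ω.measure μ) ∂μ := hswap.symm
    _ = _ := by
      refine integral_congr_ae (ae_of_all _ fun r => ?_)
      simp only [map_smul, toL1_ofCc, hI, leftTranslate_apply, smul_eq_mul, integral_const_mul]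

theorem ofCc_mem_positiveCone {f : C_c(G, ℝ)} (hf : ∀ s, 0 ≤ f s) :
    ofCc ω μ f ∈ positiveCone ω μ :=
  subset_closure ⟨f, hf, rfl⟩

theorem continuous_mulL : Continuous fun p : BeurlingAlgebra ω μ × BeurlingAlgebra ω μ =>
    p.1 * p.2 :=
  (mulL (ω := ω) (μ := μ)).continuous₂

end BeurlingAlgebra

namespace IsApproximateIdentity

variable {G : Type*} [Group G] [TopologicalSpace G] [IsTopologicalGroup G] [LocallyCompactSpace G]
  [MeasurableSpace G] [BorelSpace G] {μ : Measure G} [μ.IsHaarMeasure] [μ.Regular]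
  {ι : Type*} {l : Filter ι} {z : ι → C_c(G, ℝ)}

/-- The product is the average of r ↦ λ_r f against a unit mass concentrating at s. -/
theorem tendsto_leftTranslate_mul (hz : IsApproximateIdentity μ l z) (ω : Weight G) (s : G)
    (f : C_c(G, ℝ)) :
    Tendsto (fun i => BeurlingAlgebra.ofCc ω μ (leftTranslate s (z i)) *
      BeurlingAlgebra.ofCc ω μ f) l (𝓝 (BeurlingAlgebra.ofCc ω μ (leftTranslate s f))) := by
  simp_rw [BeurlingAlgebra.ofCc_mul_ofCc]
  exact hz.tendsto_integral_leftTranslate (BeurlingAlgebra.continuous_ofCc_leftTranslate f) s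

theorem eventually_norm_le (hz : IsApproximateIdentity μ l z) (ω : Weight G) {V : Set G}
    (hV : V ∈ 𝓝 (1 : G)) {b : ℝ} (hb : ∀ s ∈ V, ω s ≤ b) (s : G) :
    ∀ᶠ i in l, ‖BeurlingAlgebra.ofCc ω μ (leftTranslate s (z i))‖ ≤ ω s * b := by
  filter_upwards [hz.integral_eq_one, hz.support_subset V hV] with i hi1 hi
  exact (BeurlingAlgebra.norm_ofCc_leftTranslate_le s _).trans (mul_le_mul_of_nonneg_left
    (BeurlingAlgebra.norm_ofCc_le_of_support_subset (hz.nonneg i) hi1 hi hb) (ω.nonneg s))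

end IsApproximateIdentity

namespace PositiveGroupRep

variable {G : Type*} [Group G] [TopologicalSpace G] [MeasurableSpace G] {ω : Weight G}
  {X : Type*} [NormedAddCommGroup X] [NormedSpace ℝ X] {C : PointedCone ℝ X}

theorem ext_op {U V : PositiveGroupRep ω C} (h : ∀ r x, U.op r x = V.op r x) : U = V := by
  have h' : U.toHom = V.toHom :=
    MonoidHom.ext fun r => Units.ext (ContinuousLinearMap.ext fun x => h r x)
  cases U
  cases V
  cases h'
  rfl

theorem op_one (U : PositiveGroupRep ω C) (x : X) : U.op 1 x = x := by
  simp [op]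

theorem op_mul (U : PositiveGroupRep ω C) (r s : G) (x : X) :
    U.op (r * s) x = U.op r (U.op s x) := by
  simp [op]

end PositiveGroupRep

section Correspondence

variable {G : Type*} [Group G] [TopologicalSpace G] [IsTopologicalGroup G] [LocallyCompactSpace G]
  [MeasurableSpace G] [BorelSpace G] {μ : Measure G} [μ.IsHaarMeasure] [μ.Regular]
  {ω : Weight G} {X : Type*} [NormedAddCommGroup X] [NormedSpace ℝ X] {C : PointedCone ℝ X}

open BeurlingAlgebra

/-! ### From group representations to algebra representations. -/

namespace PositiveGroupRep

omit [IsTopologicalGroup G] [LocallyCompactSpace G] [μ.Regular] in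
theorem integrable_smul_op (U : PositiveGroupRep ω C) (f : C_c(G, ℝ)) (x : X) :
    Integrable (fun r => f r • U.op r x) μ :=
  f.integrable_smul (U.strongly_continuous x)

theorem norm_integral_smul_op_le (U : PositiveGroupRep ω C) {c : ℝ}
    (hc : ∀ r, ‖U.op r‖ ≤ c * ω r) (f : C_c(G, ℝ)) (x : X) :
    ‖∫ r, f r • U.op r x ∂μ‖ ≤ c * ‖ofCc ω μ f‖ * ‖x‖ := by
  have hi : Integrable (fun r => |f r| * ω r) μ :=
    ω.integrable_mul μ f.continuous.abs (f.hasCompactSupport.comp_left abs_zero)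
  rw [norm_ofCc, ← integral_const_mul, ← integral_mul_const]
  refine norm_integral_le_of_norm_le ((hi.const_mul c).mul_const ‖x‖) (ae_of_all _ fun r => ?_)
  rw [norm_smul, Real.norm_eq_abs]
  have h := mul_le_mul_of_nonneg_left ((U.op r).le_of_opNorm_le (hc r) x) (abs_nonneg (f r))
  linarith

variable (μ) in
/-- The integrated form `f ↦ ∫ f(r) U_r dr` on `C_c(G)`. -/
noncomputable def ccCLM (U : PositiveGroupRep ω C) : WeightedCc ω μ →L[ℝ] X →L[ℝ] X :=
  LinearMap.mkContinuous₂
    (LinearMap.mk₂ ℝ (fun f x => ∫ r, f r • U.op r x ∂μ)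
      (fun f g x => by
        simp only [WeightedCc.add_apply, add_smul]
        exact integral_add (U.integrable_smul_op f x) (U.integrable_smul_op g x))
      (fun c f x => by
        simp only [WeightedCc.smul_apply, mul_smul]
        exact integral_smul _ _)
      (fun f x y => by
        simp only [map_add, smul_add]
        exact integral_add (U.integrable_smul_op f x) (U.integrable_smul_op f y))
      (fun c f x => by
        simp only [map_smul, smul_comm _ c]
        exact integral_smul _ _))
    U.bounded.choose fun f x => by
      rw [← Completion.norm_coe (E := WeightedCc ω μ) f]
      exact U.norm_integral_smul_op_le U.bounded.choose_spec.2 f x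

variable [CompleteSpace X]

variable (μ) in
/-- The integrated form of `U` on `L¹(G, ω)`. -/
noncomputable def integratedCLM (U : PositiveGroupRep ω C) : BeurlingAlgebra ω μ →L[ℝ] X →L[ℝ] X :=
  (U.ccCLM μ).extend Completion.toComplL

theorem integratedCLM_ofCc (U : PositiveGroupRep ω C) (f : C_c(G, ℝ)) (x : X) :
    U.integratedCLM μ (ofCc ω μ f) x = ∫ r, f r • U.op r x ∂μ :=
  congrArg (· x) <| ContinuousLinearMap.extend_eq
    (e := Completion.toComplL (𝕜 := ℝ) (E := WeightedCc ω μ)) (U.ccCLM μ)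
    Completion.denseRange_coe (Completion.isUniformInducing_coe _) f

theorem norm_integratedCLM_le (U : PositiveGroupRep ω C) {c : ℝ} (hc0 : 0 ≤ c)
    (hc : ∀ r, ‖U.op r‖ ≤ c * ω r) : ‖U.integratedCLM μ‖ ≤ c := by
  refine ContinuousLinearMap.opNorm_le_bound _ hc0 fun a => ?_
  refine isClosed_property denseRange_ofCc (p := fun a => ‖U.integratedCLM μ a‖ ≤ c * ‖a‖)
    (isClosed_le (U.integratedCLM μ).continuous.norm (continuous_const.mul continuous_norm))
    (fun f => ?_) a
  refine ContinuousLinearMap.opNorm_le_bound _ (by positivity) fun x => ?_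
  rw [integratedCLM_ofCc]
  exact U.norm_integral_smul_op_le hc f x

/-- Covariance, by the substitution r ↦ sr and left invariance. -/
theorem op_integratedCLM_ofCc (U : PositiveGroupRep ω C) (s : G) (f : C_c(G, ℝ)) (x : X) :
    U.op s (U.integratedCLM μ (ofCc ω μ f) x) =
      U.integratedCLM μ (ofCc ω μ (leftTranslate s f)) x := by
  rw [integratedCLM_ofCc, integratedCLM_ofCc,
    ← ContinuousLinearMap.integral_comp_comm _ (U.integrable_smul_op f x),
    ← integral_mul_left_eq_self (μ := μ) (fun r => leftTranslate s f r • U.op r x) s]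
  simp [leftTranslate_apply, op_mul]

/-- On C_c(G), T(f * g)x = ∫ f(r) T(λ_r g)x dr = ∫ f(r) U_r T(g)x dr = T(f)T(g)x; density and
continuity do the rest. -/
theorem integratedCLM_mul (U : PositiveGroupRep ω C) (a b : BeurlingAlgebra ω μ) :
    U.integratedCLM μ (a * b) = U.integratedCLM μ a * U.integratedCLM μ b := by
  refine isClosed_property2 denseRange_ofCc
    (p := fun a b => U.integratedCLM μ (a * b) = U.integratedCLM μ a * U.integratedCLM μ b)
    (isClosed_eq ((U.integratedCLM μ).continuous.comp continuous_mulL)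
      (((U.integratedCLM μ).continuous.comp continuous_fst).mul
        ((U.integratedCLM μ).continuous.comp continuous_snd))) (fun f g => ?_) a b
  ext x
  have hint := f.integrable_smul (μ := μ) (continuous_ofCc_leftTranslate (ω := ω) (μ := μ) g)
  rw [mul_apply_eq_comp, integratedCLM_ofCc U f, ofCc_mul_ofCc]
  have h := ContinuousLinearMap.integral_comp_comm
    ((ContinuousLinearMap.apply ℝ X x).comp (U.integratedCLM μ)) hint
  refine h.symm.trans (integral_congr_ae (ae_of_all _ fun r => ?_))
  simp [op_integratedCLM_ofCc]

theorem tendsto_integratedCLM (U : PositiveGroupRep ω C) {ι : Type*} {l : Filter ι}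
    {z : ι → C_c(G, ℝ)} (hz : IsApproximateIdentity μ l z) (s : G) (x : X) :
    Tendsto (fun i => U.integratedCLM μ (ofCc ω μ (leftTranslate s (z i))) x) l
      (𝓝 (U.op s x)) := by
  simp_rw [integratedCLM_ofCc]
  exact hz.tendsto_integral_leftTranslate (U.strongly_continuous x) s

variable (μ) in
/-- The positive algebra representation obtained by integrating `U`. -/
noncomputable def toAlgebraRep (U : PositiveGroupRep ω C) (hC : IsClosed (C : Set X)) :
    PositiveAlgebraRep ω μ C where
  toCLM := U.integratedCLM μ
  map_mul := U.integratedCLM_mul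
  map_mem a ha x hx := by
    refine closure_minimal (t := {a | U.integratedCLM μ a x ∈ C}) ?_
      (hC.preimage ((U.integratedCLM μ).continuous.clm_apply continuous_const)) ha
    rintro _ ⟨f, hf, rfl⟩
    change U.integratedCLM μ (ofCc ω μ f) x ∈ C
    rw [integratedCLM_ofCc]
    exact C.integral_mem_of_hasCompactSupport hC (f.continuous.smul (U.strongly_continuous x))
      f.hasCompactSupport.smul_right fun r => C.smul_mem (hf r) (U.map_mem r x hx)
  nondegenerate x := by
    -- Every x is the limit of the vectors T(z_V)x.
    have h := U.tendsto_integratedCLM (isApproximateIdentity_bump μ) 1 x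
    rw [op_one] at h
    exact mem_closure_of_tendsto h (.of_forall fun i => Submodule.subset_span ⟨_, _, rfl⟩)

end PositiveGroupRep

/-! ### From algebra representations to group representations. -/

namespace PositiveAlgebraRep

theorem ext_ofCc {S T : PositiveAlgebraRep ω μ C}
    (h : ∀ f x, S.toCLM (ofCc ω μ f) x = T.toCLM (ofCc ω μ f) x) : S = T := by
  have h' : S.toCLM = T.toCLM := by
    refine ContinuousLinearMap.ext fun a => ?_
    exact isClosed_property denseRange_ofCc (p := fun a => S.toCLM a = T.toCLM a)
      (isClosed_eq S.toCLM.continuous T.toCLM.continuous)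
      (fun f => ContinuousLinearMap.ext (h f)) a
  cases S
  cases T
  cases h'
  rfl

variable (T : PositiveAlgebraRep ω μ C)

theorem dense_span_ofCc :
    Dense (Submodule.span ℝ {y : X | ∃ f x, y = T.toCLM (ofCc ω μ f) x} : Set X) := by
  have h : Submodule.span ℝ {y : X | ∃ f x, y = T.toCLM f x} ≤
      (Submodule.span ℝ {y : X | ∃ f x, y = T.toCLM (ofCc ω μ f) x}).topologicalClosure := by
    rw [Submodule.span_le]
    rintro _ ⟨a, x, rfl⟩
    exact isClosed_property denseRange_ofCc (p := fun a => T.toCLM a x ∈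
        (Submodule.span ℝ {y : X | ∃ f x, y = T.toCLM (ofCc ω μ f) x}).topologicalClosure)
      ((Submodule.isClosed_topologicalClosure _).preimage
        (T.toCLM.continuous.clm_apply continuous_const))
      (fun f => Submodule.le_topologicalClosure _ (Submodule.subset_span ⟨f, x, rfl⟩)) a
  intro x
  have := closure_mono (SetLike.coe_subset_coe.2 h) (T.nondegenerate x)
  rwa [(Submodule.isClosed_topologicalClosure _).closure_eq] at this

theorem ext_of_comp {A B : X →L[ℝ] X}
    (h : ∀ f x, A (T.toCLM (ofCc ω μ f) x) = B (T.toCLM (ofCc ω μ f) x)) : A = B := by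
  refine ContinuousLinearMap.ext_on T.dense_span_ofCc ?_
  rintro _ ⟨f, x, rfl⟩
  exact h f x

section

variable {ι : Type*} {l : Filter ι} {z : ι → C_c(G, ℝ)}

theorem tendsto_leftTranslate (hz : IsApproximateIdentity μ l z) (s : G) (f : C_c(G, ℝ)) (x : X) :
    Tendsto (fun i => T.toCLM (ofCc ω μ (leftTranslate s (z i))) (T.toCLM (ofCc ω μ f) x)) l
      (𝓝 (T.toCLM (ofCc ω μ (leftTranslate s f)) x)) := by
  have h := ((T.toCLM.continuous.clm_apply (continuous_const (y := x))).tendsto _).comp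
    (hz.tendsto_leftTranslate_mul ω s f)
  simpa [Function.comp_def, T.map_mul] using h

theorem eventually_norm_le (hz : IsApproximateIdentity μ l z) {V : Set G} (hV : V ∈ 𝓝 (1 : G))
    {b : ℝ} (hb : ∀ s ∈ V, ω s ≤ b) (s : G) :
    ∀ᶠ i in l, ‖T.toCLM (ofCc ω μ (leftTranslate s (z i)))‖ ≤ ‖T.toCLM‖ * (ω s * b) := by
  filter_upwards [hz.eventually_norm_le ω hV hb s] with i hi
  exact (T.toCLM.le_opNorm _).trans (mul_le_mul_of_nonneg_left hi (norm_nonneg _))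

end

variable [CompleteSpace X]

/-- Obtaining U_s as a strong limit avoids checking that T(f)x ↦ T(λ_s f)x is well defined and
bounded on the span. -/
theorem exists_tendsto_bump (s : G) : ∃ B : X →L[ℝ] X, ∀ x, Tendsto
    (fun V => T.toCLM (ofCc ω μ (leftTranslate s (bump μ V))) x)
    ((𝓝 (1 : G)).smallSets ⊓ 𝓟 {V | V ∈ 𝓝 (1 : G)}) (𝓝 (B x)) := by
  obtain ⟨V, hV, b, hb⟩ := ω.exists_bound_nhds_one μ
  refine ContinuousLinearMap.exists_tendsto_of_dense_span
    (T.eventually_norm_le (isApproximateIdentity_bump μ) hV hb s) T.dense_span_ofCc ?_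
  rintro _ ⟨f, x, rfl⟩
  exact ⟨_, T.tendsto_leftTranslate (isApproximateIdentity_bump μ) s f x⟩

/-- The operators `U_s` with `U_s T(f) = T(f(s⁻¹ ·))`. -/
noncomputable def groupOp (s : G) : X →L[ℝ] X := (T.exists_tendsto_bump s).choose

theorem groupOp_apply (s : G) (f : C_c(G, ℝ)) (x : X) :
    T.groupOp s (T.toCLM (ofCc ω μ f) x) = T.toCLM (ofCc ω μ (leftTranslate s f)) x :=
  tendsto_nhds_unique ((T.exists_tendsto_bump s).choose_spec _)
    (T.tendsto_leftTranslate (isApproximateIdentity_bump μ) s f x)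

theorem tendsto_groupOp {ι : Type*} {l : Filter ι} {z : ι → C_c(G, ℝ)}
    (hz : IsApproximateIdentity μ l z) (s : G) (x : X) :
    Tendsto (fun i => T.toCLM (ofCc ω μ (leftTranslate s (z i))) x) l (𝓝 (T.groupOp s x)) := by
  obtain ⟨V, hV, b, hb⟩ := ω.exists_bound_nhds_one μ
  refine ContinuousLinearMap.tendsto_of_dense_span
    (T.eventually_norm_le hz hV hb s) T.dense_span_ofCc ?_ x
  rintro _ ⟨f, x, rfl⟩
  rw [groupOp_apply]
  exact T.tendsto_leftTranslate hz s f x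

/-- The norm bound survives strong limits. `V` and `b` stay free so that `b` can later approach 1.
-/
theorem norm_groupOp_le {V : Set G} (hV : V ∈ 𝓝 (1 : G)) {b : ℝ} (hb : ∀ s ∈ V, ω s ≤ b) (s : G) :
    ‖T.groupOp s‖ ≤ ‖T.toCLM‖ * (ω s * b) := by
  have hb0 : 0 ≤ b := (ω.nonneg 1).trans (hb 1 (mem_of_mem_nhds hV))
  have hs := ω.nonneg s
  refine ContinuousLinearMap.opNorm_le_bound _ (by positivity) fun x => ?_
  refine le_of_tendsto (T.tendsto_groupOp (isApproximateIdentity_bump μ) s x).norm ?_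
  filter_upwards [T.eventually_norm_le (isApproximateIdentity_bump μ) hV hb s] with W hW
  exact ContinuousLinearMap.le_of_opNorm_le _ hW x

theorem continuous_groupOp (x : X) : Continuous fun s => T.groupOp s x := by
  rw [continuous_iff_continuousAt]
  intro s
  obtain ⟨V, hV, b, hb⟩ := ω.exists_bound_nhds_one μ
  obtain ⟨K, hK, hKs⟩ := exists_compact_mem_nhds s
  obtain ⟨c, hc⟩ := ω.exists_bound μ hK
  have hb0 : 0 ≤ b := (ω.nonneg 1).trans (hb 1 (mem_of_mem_nhds hV))
  -- Local boundedness of ω bounds U_r uniformly for r in K, so continuity need only be checked on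
  -- the vectors T(f)x, where it is continuity of translation.
  refine ContinuousLinearMap.tendsto_of_dense_span (M := ‖T.toCLM‖ * (c * b)) ?_
    T.dense_span_ofCc ?_ x
  · filter_upwards [hKs] with r hr
    refine (T.norm_groupOp_le hV hb r).trans ?_
    gcongr
    exact hc r hr
  · rintro _ ⟨f, x, rfl⟩
    simp_rw [groupOp_apply]
    exact ((T.toCLM.continuous.comp (continuous_ofCc_leftTranslate f)).clm_apply
      continuous_const).tendsto s

theorem groupOp_mem (hC : IsClosed (C : Set X)) (s : G) {x : X} (hx : x ∈ C) :
    T.groupOp s x ∈ C :=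
  hC.mem_of_tendsto (T.tendsto_groupOp (isApproximateIdentity_bump μ) s x)
    (.of_forall fun V => T.map_mem _ (ofCc_mem_positiveCone fun r =>
      (isApproximateIdentity_bump μ).nonneg V (s⁻¹ * r)) x hx)

/-- The operators `U_s` as a monoid homomorphism. -/
noncomputable def groupOpHom : G →* (X →L[ℝ] X) where
  toFun := T.groupOp
  map_one' := T.ext_of_comp fun f x => by
    rw [groupOp_apply, leftTranslate_one, one_apply_eq_self]
  map_mul' s t := T.ext_of_comp fun f x => by
    rw [groupOp_apply, leftTranslate_mul, mul_apply_eq_comp, groupOp_apply,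
      groupOp_apply]

/-- The positive group representation underlying `T`. -/
noncomputable def toGroupRep (hC : IsClosed (C : Set X)) : PositiveGroupRep ω C where
  toHom := T.groupOpHom.toHomUnits
  map_mem r _ hx := T.groupOp_mem hC r hx
  inv_map_mem r x hx := by
    rw [← map_inv]
    exact T.groupOp_mem hC r⁻¹ hx
  strongly_continuous := T.continuous_groupOp
  bounded := by
    obtain ⟨V, hV, b, hb⟩ := ω.exists_bound_nhds_one μ
    have hb0 : 0 ≤ b := (ω.nonneg 1).trans (hb 1 (mem_of_mem_nhds hV))
    refine ⟨‖T.toCLM‖ * b, by positivity, fun r => (T.norm_groupOp_le hV hb r).trans_eq ?_⟩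
    ring

theorem toGroupRep_op (hC : IsClosed (C : Set X)) (r : G) :
    (T.toGroupRep hC).op r = T.groupOp r := rfl

theorem toAlgebraRep_toGroupRep (hC : IsClosed (C : Set X)) :
    (T.toGroupRep hC).toAlgebraRep μ hC = T := by
  refine ext_ofCc fun f y => ?_
  suffices h : (T.toGroupRep hC).integratedCLM μ (ofCc ω μ f) = T.toCLM (ofCc ω μ f) from
    congrArg (· y) h
  -- After composing with T(g), both sides equal ∫ f(r) T(λ_r g)x dr.
  refine T.ext_of_comp fun g x => ?_
  have hint := f.integrable_smul (μ := μ) (continuous_ofCc_leftTranslate (ω := ω) (μ := μ) g)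
  rw [PositiveGroupRep.integratedCLM_ofCc, ← mul_apply_eq_comp, ← T.map_mul,
    ofCc_mul_ofCc]
  have h := ContinuousLinearMap.integral_comp_comm
    ((ContinuousLinearMap.apply ℝ X x).comp T.toCLM) hint
  refine Eq.trans (integral_congr_ae (ae_of_all _ fun r => ?_)) h
  simp [toGroupRep_op, groupOp_apply]

theorem norm_groupOp_le_of_infSup_eq_one {𝒵 : Set (Set G)} (h𝒵 : IsCompactlyBoundedBase 𝒵)
    (hω : ω.infSup 𝒵 = 1) (r : G) : ‖T.groupOp r‖ ≤ ‖T.toCLM‖ * ω r := by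
  obtain ⟨hbase, K, hK, h𝒵K⟩ := h𝒵
  obtain ⟨B, hB⟩ := ω.exists_bound μ hK
  have hne : Nonempty 𝒵 := by
    obtain ⟨V, hV, -⟩ := hbase.mem_iff.1 univ_mem
    exact ⟨⟨V, hV⟩⟩
  -- The infimum need not be attained, so each b > 1 is treated separately and then b ↓ 1. The
  -- compact set K makes each supremum over W a genuine upper bound.
  have hlt : ∀ b : ℝ, 1 < b → ‖T.groupOp r‖ ≤ ‖T.toCLM‖ * (ω r * b) := by
    intro b hb
    rw [← hω] at hb
    obtain ⟨W, hW⟩ := exists_lt_of_ciInf_lt hb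
    refine T.norm_groupOp_le (hbase.mem_of_mem W.2) (fun s hs => ?_) r
    refine (le_ciSup (f := fun r : (W : Set G) => ω r) ⟨B, ?_⟩ ⟨s, hs⟩).trans hW.le
    rintro _ ⟨t, rfl⟩
    exact hB t (h𝒵K W W.2 t.2)
  have ht : Tendsto (fun b : ℝ => ‖T.toCLM‖ * (ω r * b)) (𝓝[>] 1) (𝓝 (‖T.toCLM‖ * (ω r * 1))) :=
    ((continuous_const.mul (continuous_const.mul continuous_id)).tendsto 1).mono_left
      nhdsWithin_le_nhds
  rw [mul_one] at ht
  exact ge_of_tendsto ht (eventually_mem_nhdsWithin.mono hlt)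

end PositiveAlgebraRep

theorem PositiveGroupRep.toGroupRep_toAlgebraRep [CompleteSpace X] (U : PositiveGroupRep ω C)
    (hC : IsClosed (C : Set X)) : (U.toAlgebraRep μ hC).toGroupRep hC = U :=
  ext_op fun r x => tendsto_nhds_unique
    ((U.toAlgebraRep μ hC).tendsto_groupOp (isApproximateIdentity_bump μ) r x)
    (U.tendsto_integratedCLM (isApproximateIdentity_bump μ) r x)

end Correspondence

/-! ### The bijection and the norm identities. -/

theorem corollary5p11
    {G : Type*} [Group G] [TopologicalSpace G] [IsTopologicalGroup G] [LocallyCompactSpace G]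
    [T2Space G] [MeasurableSpace G] [BorelSpace G]
    (μ : Measure G) [μ.IsHaarMeasure] [μ.Regular] (ω : Weight G)
    {X : Type*} [NormedAddCommGroup X] [NormedSpace ℝ X] [CompleteSpace X]
    (C : PointedCone ℝ X) (hC : IsClosed (C : Set X)) :
    ∃ Φ : PositiveGroupRep ω C ≃ PositiveAlgebraRep ω μ C,
      -- `T^U(f) = ∫ f(r) U_r dr` for `f ∈ C_c(G)`
      (∀ (U : PositiveGroupRep ω C) (f : C_c(G, ℝ)) (x : X),
        (Φ U).toCLM (BeurlingAlgebra.ofCc ω μ f) x = ∫ r, f r • U.op r x ∂μ) ∧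
      -- `U^T_s = SOT-lim_V T(z_V(s⁻¹ ·))`
      (∀ 𝒵 : Set (Set G), IsCompactlyBoundedBase 𝒵 →
        ∀ z : 𝒵 → C_c(G, ℝ),
          (∀ V s, 0 ≤ z V s) → (∀ V, Function.support (z V) ⊆ (V : Set G)) →
          (∀ V, ∫ r, z V r ∂μ = 1) →
          ∀ (T : PositiveAlgebraRep ω μ C) (s : G) (x : X),
            Tendsto (fun V : 𝒵 => T.toCLM (BeurlingAlgebra.ofCc ω μ (leftTranslate s (z V))) x)
              atBot (𝓝 ((Φ.symm T).op s x))) ∧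
      -- the norm identities for a weight that is normalized near `e`
      (∀ 𝒵 : Set (Set G), IsCompactlyBoundedBase 𝒵 →
        ω.infSup 𝒵 = 1 →
          (∀ U : PositiveGroupRep ω C,
            IsLUB (Set.range fun r => ‖U.op r‖ / ω r) ‖(Φ U).toCLM‖) ∧
          (∀ (T : PositiveAlgebraRep ω μ C) (r : G),
            ‖(Φ.symm T).op r‖ ≤ ‖T.toCLM‖ * ω r)) := by
  let Φ : PositiveGroupRep ω C ≃ PositiveAlgebraRep ω μ C :=
    { toFun := fun U => U.toAlgebraRep μ hC
      invFun := fun T => T.toGroupRep hC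
      left_inv := fun U => U.toGroupRep_toAlgebraRep hC
      right_inv := fun T => T.toAlgebraRep_toGroupRep hC }
  refine ⟨Φ, fun U f x => U.integratedCLM_ofCc f x, ?_, ?_⟩
  · intro 𝒵 h𝒵 z h0 hs h1 T s x
    exact T.tendsto_groupOp (h𝒵.isApproximateIdentity h0 hs h1) s x
  · intro 𝒵 h𝒵 hω
    have hT : ∀ (T : PositiveAlgebraRep ω μ C) (r : G),
        ‖(Φ.symm T).op r‖ ≤ ‖T.toCLM‖ * ω r :=
      fun T r => T.norm_groupOp_le_of_infSup_eq_one h𝒵 hω r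
    refine ⟨fun U => ⟨?_, fun c hc => ?_⟩, hT⟩
    · rintro _ ⟨r, rfl⟩
      rw [div_le_iff₀ (ω.pos r)]
      -- Here U is the group representation recovered from Φ U.
      simpa using hT (Φ U) r
    · refine U.norm_integratedCLM_le ?_ fun r => ?_
      -- An upper bound c is nonnegative because it dominates the quotient at r = 1.
      · exact (div_nonneg (norm_nonneg _) (ω.nonneg 1)).trans (hc ⟨1, rfl⟩)
      · exact (div_le_iff₀ (ω.pos r)).1 (hc ⟨r, rfl⟩)
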